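/- Let $Y\xrightarrow{\pi}\Sigma\xrightarrow{\rho}X$ be a composite bundle, i.e. $\pi$ and $\rho$ are smooth locally trivial fiber bundles (for instance $\Sigma=P/H$ and $Y=(P\times V)/H$ for a principal $G$-bundle $P\to X$, a closed subgroup $H\subset G$ and a manifold $V$ with a smooth left $H$-action). Let $A$ be a connection on $Y\to\Sigma$, i.e. a smooth section of $J^1_\Sigma Y\to Y$, equivalently a smooth family of splittings $A_y:T_{\pi(y)}\Sigma\to T_yY$, $T_y\pi\circ A_y=\mathrm{id}$; in fibered coordinates $(x^\lambda,\sigma^m,y^i)$, $$A=dx^\lambda\otimes(\partial_\lambda+A^i_\lambda\partial_i)+d\sigma^m\otimes(\partial_m+A^i_m\partial_i)$$ (for instance the connection associated to a principal connection on $P\to P/H$). Let $$\widetilde D:J^1Y\to T^*X\otimes_Y V_\Sigma Y,\qquad \widetilde D=dx^\lambda\otimes(y^i_\lambda-A^i_\lambda-A^i_m\sigma^m_\lambda)\,\partial_i ,$$ be the vertical covariant differential on the composite bundle $Y\to X$; here $V_\Sigma Y=\ker T\pi$ and, regarding a jet $\Gamma\in J^1Y$ at $y$ over $x$ as a linear map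 $\Gamma:T_xX\to T_yY$ with $T_y(\rho\circ\pi)\circ\Gamma=\mathrm{id}$, one has $\widetilde D(\Gamma)=\Gamma-A_y\circ T_y\pi\circ\Gamma$. Let $h:X\to\Sigma$ be any global smooth section of $\rho$. Let $Y^h=h^*Y\to X$ be the pull-back of $Y\to\Sigma$ along $h$, with its canonical inclusion $i_h:Y^h\to Y$, and let $A_h=h^*A$ be the pull-back connection on $Y^h\to X$, i.e. the connection with $Ti_h\circ (A_h)_z=A_{i_h(z)}\circ Th$ for $z\in Y^h$; in coordinates $$A_h=dx^\lambda\otimes[\partial_\lambda+(A^i_m(x,h(x),y)\,\partial_\lambda h^m+A^i_\lambda(x,h(x),y))\,\partial_i].$$ Let $D^{A_h}:J^1Y^h\to T^*X\otimes VY^h$, $D^{A_h}(\Gamma)=\Gamma-(A_h)_z$ for a jet $\Gamma$ at $z\in Y^h$, be the covariant differential of $A_h$. Then the restriction of $\widetilde D$ to $Y^h$ coincides with $D^{A_h}$: under the identification of $VY^h$ with $i_h^*V_\Sigma Y$ given by $Ti_h$, $$\widetilde D\circ J^1i_h=Ti_h\circ D^{A_h}\quad\text{on } J^1Y^h .$$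 In particular $\widetilde D(i_h\circ s)=Ti_h\circ D^{A_h}s$ for every global smooth section $s$ of $Y^h\to X$. -/

import Mathlib

open scoped Manifold ContDiff Topology

set_option linter.unusedSectionVars false

noncomputable section

namespace CompositeBundle

section General

variable {EM : Type*} [NormedAddCommGroup EM] [NormedSpace ℝ EM]
  {HM : Type*} [TopologicalSpace HM] (IM : ModelWithCorners ℝ EM HM)
  {M : Type*} [TopologicalSpace M] [ChartedSpace HM M]

/-- The identity map between the tangent spaces at two points known to be equal. -/
def tangentCast {x x' : M} (h : x = x') : TangentSpace IM x →L[ℝ] TangentSpace IM x' :=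
  h ▸ ContinuousLinearMap.id ℝ (TangentSpace IM x)

@[simp] theorem tangentCast_rfl {x : M} (h : x = x) :
    tangentCast IM h = ContinuousLinearMap.id ℝ (TangentSpace IM x) := rfl

theorem tangentCast_apply {x x' : M} (h : x = x') (v : EM) :
    (tangentCast IM h : EM →L[ℝ] EM) v = v := by
  cases h; rfl

variable {IM}
  {EM' : Type*} [NormedAddCommGroup EM'] [NormedSpace ℝ EM']
  {HM' : Type*} [TopologicalSpace HM'] {IM' : ModelWithCorners ℝ EM' HM'}
  {M' : Type*} [TopologicalSpace M'] [ChartedSpace HM' M']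
  {EN : Type*} [NormedAddCommGroup EN] [NormedSpace ℝ EN]
  {HN : Type*} [TopologicalSpace HN] {IN : ModelWithCorners ℝ EN HN}
  {N : Type*} [TopologicalSpace N] [ChartedSpace HN N]

theorem mfderiv_comp_raw {g : M' → N} {f : M → M'} {x : M} {y : M'} (hy : f x = y)
    (hg : MDifferentiableAt IM' IN g y) (hf : MDifferentiableAt IM IM' f x) (v : EM) :
    (mfderiv IM IN (g ∘ f) x : EM →L[ℝ] EN) v =
      (mfderiv IM' IN g y : EM' →L[ℝ] EN) ((mfderiv IM IM' f x : EM →L[ℝ] EM') v) := by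
  subst hy
  rw [mfderiv_comp x hg hf]; rfl

theorem mfderiv_prodMk_raw {f : N → M} {g : N → M'} {x : N} (hf : MDifferentiableAt IN IM f x)
    (hg : MDifferentiableAt IN IM' g x) (v : EN) :
    (mfderiv IN (IM.prod IM') (fun x => (f x, g x)) x : EN →L[ℝ] EM × EM') v =
      ((mfderiv IN IM f x : EN →L[ℝ] EM) v, (mfderiv IN IM' g x : EN →L[ℝ] EM') v) := by
  rw [mfderiv_prodMk hf hg]; rfl

section

variable [IsManifold IM 1 M] [IsManifold IM' 1 M']

theorem inTangentCoordinates_congr {f f' : N → M} {g g' : N → M'} {φ φ' : N → EM →L[ℝ] EM'}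
    {x₀ : N} (hf : f =ᶠ[𝓝 x₀] f') (hg : g =ᶠ[𝓝 x₀] g') (hφ : φ =ᶠ[𝓝 x₀] φ') :
    inTangentCoordinates IM IM' f g φ x₀ =ᶠ[𝓝 x₀] inTangentCoordinates IM IM' f' g' φ' x₀ := by
  filter_upwards [hf, hg, hφ] with x h1 h2 h3
  have h1' := hf.self_of_nhds
  have h2' := hg.self_of_nhds
  have key : ∀ (a a' a₀ a₀' : M) (c c' c₀ c₀' : M') (ψ ψ' : EM →L[ℝ] EM'), a = a' → a₀ = a₀' →
      c = c' → c₀ = c₀' → ψ = ψ' →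
      (ContinuousLinearMap.inCoordinates EM (TangentSpace IM) EM' (TangentSpace IM') a₀ a c₀ c ψ)
        = (ContinuousLinearMap.inCoordinates EM (TangentSpace IM) EM' (TangentSpace IM')
          a₀' a' c₀' c' ψ') := by
    rintro a _ a₀ _ c _ c₀ _ ψ _ rfl rfl rfl rfl rfl; rfl
  exact key _ _ _ _ _ _ _ _ _ _ h1 h1' h2 h2' h3

theorem inTangentCoordinates_add {f : N → M} {g : N → M'} {φ ψ : N → EM →L[ℝ] EM'} {x₀ : N}
    (hφ : ContMDiffAt IN 𝓘(ℝ, EM →L[ℝ] EM') ∞ (inTangentCoordinates IM IM' f g φ x₀) x₀)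
    (hψ : ContMDiffAt IN 𝓘(ℝ, EM →L[ℝ] EM') ∞ (inTangentCoordinates IM IM' f g ψ x₀) x₀) :
    ContMDiffAt IN 𝓘(ℝ, EM →L[ℝ] EM') ∞
      (inTangentCoordinates IM IM' f g (fun x => φ x + ψ x) x₀) x₀ := by
  have h := hφ.add hψ
  refine h.congr_of_eventuallyEq (Filter.Eventually.of_forall fun x => ?_)
  ext v
  exact map_add (Bundle.Trivialization.continuousLinearMapAt ℝ
    (trivializationAt EM' (TangentSpace IM') (g x₀)) (g x)) _ _

variable {EL : Type*} [NormedAddCommGroup EL] [NormedSpace ℝ EL]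
  {HL : Type*} [TopologicalSpace HL] {IL : ModelWithCorners ℝ EL HL}
  {L : Type*} [TopologicalSpace L] [ChartedSpace HL L] [IsManifold IL 1 L]

theorem inTangentCoordinates_comp {f : N → M} {g : N → M'} {k : N → L} {φ : N → EM →L[ℝ] EM'}
    {ψ : N → EM' →L[ℝ] EL} {x₀ : N}
    (hψ : ContMDiffAt IN 𝓘(ℝ, EM' →L[ℝ] EL) ∞ (inTangentCoordinates IM' IL g k ψ x₀) x₀)
    (hφ : ContMDiffAt IN 𝓘(ℝ, EM →L[ℝ] EM') ∞ (inTangentCoordinates IM IM' f g φ x₀) x₀)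
    (hg : ContinuousAt g x₀) :
    ContMDiffAt IN 𝓘(ℝ, EM →L[ℝ] EL) ∞
      (inTangentCoordinates IM IL f k (fun x => ψ x ∘L φ x) x₀) x₀ := by
  have h := hψ.clm_comp hφ
  refine h.congr_of_eventuallyEq ?_
  have hb : ∀ᶠ x in 𝓝 x₀, g x ∈ (trivializationAt EM' (TangentSpace IM') (g x₀)).baseSet :=
    hg ((trivializationAt EM' (TangentSpace IM') (g x₀)).open_baseSet.mem_nhds
      (FiberBundle.mem_baseSet_trivializationAt EM' (TangentSpace IM') (g x₀)))
  filter_upwards [hb] with x hx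
  ext v
  have e := Bundle.Trivialization.symmL_continuousLinearMapAt (R := ℝ)
    (trivializationAt EM' (TangentSpace IM') (g x₀)) hx
    (φ x ((trivializationAt EM (TangentSpace IM) (f x₀)).symmL ℝ (f x) v))
  change (trivializationAt EL (TangentSpace IL) (k x₀)).continuousLinearMapAt ℝ (k x) (ψ x _) =
    (trivializationAt EL (TangentSpace IL) (k x₀)).continuousLinearMapAt ℝ (k x) (ψ x
    ((trivializationAt EM' (TangentSpace IM') (g x₀)).symmL ℝ (g x) _))
  congr 2
  exact e.symm

end

end General

/-- A smooth (locally trivial) fiber bundle `Y → B` with typical fiber `F`: a smooth projection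
together with a smooth local trivialization over a neighbourhood of each point of the base. -/
structure SmoothFiberBundle
    {EY : Type*} [NormedAddCommGroup EY] [NormedSpace ℝ EY]
    {HY : Type*} [TopologicalSpace HY] (IY : ModelWithCorners ℝ EY HY)
    (Y : Type*) [TopologicalSpace Y] [ChartedSpace HY Y]
    {EB : Type*} [NormedAddCommGroup EB] [NormedSpace ℝ EB]
    {HB : Type*} [TopologicalSpace HB] (IB : ModelWithCorners ℝ EB HB)
    (B : Type*) [TopologicalSpace B] [ChartedSpace HB B]
    {EF : Type*} [NormedAddCommGroup EF] [NormedSpace ℝ EF]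
    {HF : Type*} [TopologicalSpace HF] (IF : ModelWithCorners ℝ EF HF)
    (F : Type*) [TopologicalSpace F] [ChartedSpace HF F] where
  /-- the bundle projection -/
  proj : Y → B
  contMDiff_proj : ContMDiff IY IB ∞ proj
  /-- a local trivialization around each point of the base -/
  trivAt : B → Bundle.Trivialization F proj
  mem_baseSet : ∀ b, b ∈ (trivAt b).baseSet
  contMDiffOn_triv : ∀ b,
    ContMDiffOn IY (IB.prod IF) ∞ (trivAt b).toOpenPartialHomeomorph (trivAt b).source
  contMDiffOn_triv_symm : ∀ b,
    ContMDiffOn (IB.prod IF) IY ∞ (trivAt b).toOpenPartialHomeomorph.symm (trivAt b).target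

section Bundle

variable
    {EY : Type*} [NormedAddCommGroup EY] [NormedSpace ℝ EY]
    {HY : Type*} [TopologicalSpace HY] {IY : ModelWithCorners ℝ EY HY}
    {Y : Type*} [TopologicalSpace Y] [ChartedSpace HY Y]
    {EB : Type*} [NormedAddCommGroup EB] [NormedSpace ℝ EB]
    {HB : Type*} [TopologicalSpace HB] {IB : ModelWithCorners ℝ EB HB}
    {B : Type*} [TopologicalSpace B] [ChartedSpace HB B]
    {EF : Type*} [NormedAddCommGroup EF] [NormedSpace ℝ EF]
    {HF : Type*} [TopologicalSpace HF] {IF : ModelWithCorners ℝ EF HF}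
    {F : Type*} [TopologicalSpace F] [ChartedSpace HF F]
    {EX : Type*} [NormedAddCommGroup EX] [NormedSpace ℝ EX]
    {HX : Type*} [TopologicalSpace HX] {IX : ModelWithCorners ℝ EX HX}
    {X : Type*} [TopologicalSpace X] [ChartedSpace HX X]

/-! ### The pull-back of a fiber bundle along a smooth map -/

/-- The total space `f^*Y = {(x, y) | f x = π y} ⊆ X × Y` of the pull-back of `π : Y → B` along
a smooth map `f : X → B`, with its projection `base : f^*Y → X` and the canonical map
`incl : f^*Y → Y` over `f`. If `f` is a section of a bundle `B → X`, then `incl` identifies `f^*Y`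
with the restriction of `Y → B` to `f(X)`, a subset of `Y`. -/
structure Pullback (π : SmoothFiberBundle IY Y IB B IF F) (f : C^∞⟮IX, X; IB, B⟯) where
  base : X
  incl : Y
  condition : f base = π.proj incl

namespace Pullback

variable {π : SmoothFiberBundle IY Y IB B IF F} {f : C^∞⟮IX, X; IB, B⟯}

theorem ext_iff' {z w : Pullback π f} : z = w ↔ z.base = w.base ∧ z.incl = w.incl := by
  cases z; cases w; simp

/-- The subspace topology induced from `X × Y`. -/
instance : TopologicalSpace (Pullback π f) :=
  TopologicalSpace.induced (fun z => (z.base, z.incl)) inferInstance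

theorem isInducing : Topology.IsInducing (fun z : Pullback π f => (z.base, z.incl)) := ⟨rfl⟩

theorem continuous_base : Continuous (base : Pullback π f → X) :=
  continuous_fst.comp isInducing.continuous

theorem continuous_incl : Continuous (incl : Pullback π f → Y) :=
  continuous_snd.comp isInducing.continuous

theorem proj_symm {b b' : B} (h : b' ∈ (π.trivAt b).baseSet) (v : F) :
    π.proj ((π.trivAt b).toOpenPartialHomeomorph.symm (b', v)) = b' :=
  (π.trivAt b).proj_symm_apply' h

open Classical in
variable (π f) in
/-- The local trivialization `(x, y) ↦ (x, pr₂ (e y))` of `f^*Y → X` induced by the local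
trivialization `e` of `Y → B` around `b`. -/
def triv (b : B) : Bundle.Trivialization F (base : Pullback π f → X) where
  toFun z := (z.base, ((π.trivAt b) z.incl).2)
  invFun p := if h : f p.1 ∈ (π.trivAt b).baseSet then
      ⟨p.1, (π.trivAt b).toOpenPartialHomeomorph.symm (f p.1, p.2), (proj_symm h _).symm⟩
    else ⟨p.1, (π.trivAt (f p.1)).toOpenPartialHomeomorph.symm (f p.1, p.2),
      (proj_symm (π.mem_baseSet _) _).symm⟩
  source := base ⁻¹' (f ⁻¹' (π.trivAt b).baseSet)
  target := (f ⁻¹' (π.trivAt b).baseSet) ×ˢ Set.univ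
  map_source' z hz := ⟨hz, trivial⟩
  map_target' p hp := by
    have h : f p.1 ∈ (π.trivAt b).baseSet := hp.1
    simp only [h, dif_pos]
    exact h
  left_inv' z hz := by
    have h : f z.base ∈ (π.trivAt b).baseSet := hz
    simp only [h, dif_pos]
    refine ext_iff'.2 ⟨rfl, ?_⟩
    change (π.trivAt b).toOpenPartialHomeomorph.symm (f z.base, ((π.trivAt b) z.incl).2) = z.incl
    rw [condition] at h ⊢
    exact (π.trivAt b).symm_apply_mk_proj ((π.trivAt b).mem_source.2 h)
  right_inv' p hp := by
    have h : f p.1 ∈ (π.trivAt b).baseSet := hp.1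
    simp only [h, dif_pos]
    refine Prod.ext rfl ?_
    change ((π.trivAt b) ((π.trivAt b).toOpenPartialHomeomorph.symm (f p.1, p.2))).2 = p.2
    rw [(π.trivAt b).apply_symm_apply' h]
  open_source := (((π.trivAt b).open_baseSet).preimage f.contMDiff.continuous).preimage
    continuous_base
  open_target := (((π.trivAt b).open_baseSet).preimage f.contMDiff.continuous).prod isOpen_univ
  continuousOn_toFun := by
    refine continuous_base.continuousOn.prodMk (continuous_snd.comp_continuousOn ?_)
    refine (π.trivAt b).continuousOn_toFun.comp continuous_incl.continuousOn ?_
    intro z hz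
    have h : f z.base ∈ (π.trivAt b).baseSet := hz
    rw [condition] at h
    exact (π.trivAt b).mem_source.2 h
  continuousOn_invFun := by
    refine (isInducing.continuousOn_iff).2 ?_
    have : ContinuousOn (fun p : X × F =>
        (p.1, (π.trivAt b).toOpenPartialHomeomorph.symm (f p.1, p.2)))
        ((f ⁻¹' (π.trivAt b).baseSet) ×ˢ Set.univ) := by
      refine continuous_fst.continuousOn.prodMk ?_
      refine (π.trivAt b).toOpenPartialHomeomorph.continuousOn_symm.comp
        ((f.contMDiff.continuous.comp continuous_fst).prodMk continuous_snd).continuousOn ?_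
      intro p hp
      exact (π.trivAt b).mem_target.2 hp.1
    refine this.congr ?_
    intro p hp
    have h : f p.1 ∈ (π.trivAt b).baseSet := hp.1
    simp only [Function.comp, h, dif_pos]
  baseSet := f ⁻¹' (π.trivAt b).baseSet
  open_baseSet := ((π.trivAt b).open_baseSet).preimage f.contMDiff.continuous
  source_eq := rfl
  target_eq := rfl
  proj_toFun _ _ := rfl

theorem triv_apply (b : B) (z : Pullback π f) :
    triv π f b z = (z.base, ((π.trivAt b) z.incl).2) := rfl

theorem incl_triv_symm {b : B} {p : X × F} (h : f p.1 ∈ (π.trivAt b).baseSet) :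
    incl ((triv π f b).toOpenPartialHomeomorph.symm p) =
      (π.trivAt b).toOpenPartialHomeomorph.symm (f p.1, p.2) := by
  classical
  change incl (dite (f p.1 ∈ (π.trivAt b).baseSet) _ _) = _
  rw [dif_pos h]

theorem base_triv_symm {b : B} {p : X × F} (h : f p.1 ∈ (π.trivAt b).baseSet) :
    base ((triv π f b).toOpenPartialHomeomorph.symm p) = p.1 := by
  classical
  change base (dite (f p.1 ∈ (π.trivAt b).baseSet) _ _) = _
  rw [dif_pos h]

theorem mem_triv_source {b : B} {z : Pullback π f} :
    z ∈ (triv π f b).source ↔ f z.base ∈ (π.trivAt b).baseSet := Iff.rfl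

theorem mem_triv_target {b : B} {p : X × F} :
    p ∈ (triv π f b).target ↔ f p.1 ∈ (π.trivAt b).baseSet :=
  ⟨fun h => h.1, fun h => ⟨h, trivial⟩⟩

theorem incl_mem_source {b : B} {z : Pullback π f} (h : z ∈ (triv π f b).source) :
    z.incl ∈ (π.trivAt b).source := by
  rw [(π.trivAt b).mem_source, ← condition]; exact h

/-- The manifold structure of `f^*Y`: its charts are the local trivializations followed by products
of charts of the base and of the typical fiber. -/
instance : ChartedSpace (ModelProd HX HF) (Pullback π f) where
  atlas := {e | ∃ b : B, ∃ c ∈ atlas (ModelProd HX HF) (X × F),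
    e = (triv π f b).toOpenPartialHomeomorph.trans c}
  chartAt z := (triv π f (f z.base)).toOpenPartialHomeomorph.trans
    (chartAt (ModelProd HX HF) (triv π f (f z.base) z))
  mem_chart_source z := by
    rw [OpenPartialHomeomorph.trans_source]
    exact ⟨π.mem_baseSet _, mem_chart_source (ModelProd HX HF) (triv π f (f z.base) z)⟩
  chart_mem_atlas z := ⟨_, _, chart_mem_atlas _ _, rfl⟩

theorem contMDiffOn_transition (b b' : B) :
    ContMDiffOn (IX.prod IF) (IX.prod IF) ∞
      ((triv π f b).toOpenPartialHomeomorph.symm.trans (triv π f b').toOpenPartialHomeomorph)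
      ((triv π f b).toOpenPartialHomeomorph.symm.trans
        (triv π f b').toOpenPartialHomeomorph).source := by
  have key0 : ContMDiff (IX.prod IF) (IB.prod IF) ∞ (fun p : X × F => (f p.1, p.2)) :=
    ContMDiff.prodMk (I := IX.prod IF) (I' := IB) (J' := IF) (n := ∞)
      (f.contMDiff.comp contMDiff_fst) contMDiff_snd
  have key : ContMDiffOn (IX.prod IF) (IX.prod IF) ∞
      (fun p : X × F => (p.1, ((π.trivAt b').toOpenPartialHomeomorph
        ((π.trivAt b).toOpenPartialHomeomorph.symm (f p.1, p.2))).2))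
      {p | f p.1 ∈ (π.trivAt b).baseSet ∧ f p.1 ∈ (π.trivAt b').baseSet} := by
    refine contMDiff_fst.contMDiffOn.prodMk (ContMDiff.comp_contMDiffOn (I' := IB.prod IF)
      contMDiff_snd ?_)
    refine (π.contMDiffOn_triv b').comp ((π.contMDiffOn_triv_symm b).comp
      key0.contMDiffOn ?_) ?_
    · intro p hp
      exact (π.trivAt b).mem_target.2 hp.1
    · intro p hp
      rw [Set.mem_preimage, (π.trivAt b').mem_source]
      rw [proj_symm hp.1]
      exact hp.2
  have hsub : ((triv π f b).toOpenPartialHomeomorph.symm.trans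
        (triv π f b').toOpenPartialHomeomorph).source ⊆
      {p | f p.1 ∈ (π.trivAt b).baseSet ∧ f p.1 ∈ (π.trivAt b').baseSet} := by
    rintro p ⟨h1, h2⟩
    have h1' := mem_triv_target.1 h1
    have h2' := mem_triv_source.1 h2
    refine ⟨h1', ?_⟩
    have e : base ((triv π f b).toOpenPartialHomeomorph.symm p) = p.1 := base_triv_symm h1'
    change f (base ((triv π f b).toOpenPartialHomeomorph.symm p)) ∈ _ at h2'
    rwa [e] at h2'
  refine (key.mono hsub).congr ?_
  intro p hp
  have h := (hsub hp).1
  rw [OpenPartialHomeomorph.coe_trans]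
  refine Prod.ext (base_triv_symm h) ?_
  change ((π.trivAt b') (incl _)).2 = _
  rw [incl_triv_symm h]; rfl

variable [IsManifold IX ∞ X] [IsManifold IF ∞ F]

theorem triv_trans_mem_groupoid {b b' : B}
    {c c' : OpenPartialHomeomorph (X × F) (ModelProd HX HF)}
    (hc : c ∈ atlas (ModelProd HX HF) (X × F)) (hc' : c' ∈ atlas (ModelProd HX HF) (X × F)) :
    ((triv π f b).toOpenPartialHomeomorph.trans c).symm.trans
      ((triv π f b').toOpenPartialHomeomorph.trans c') ∈ contDiffGroupoid ∞ (IX.prod IF) := by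
  have mc := IsManifold.subset_maximalAtlas (I := IX.prod IF) (n := ∞) hc
  have mc' := IsManifold.subset_maximalAtlas (I := IX.prod IF) (n := ∞) hc'
  have h1 : ((triv π f b).toOpenPartialHomeomorph.symm.trans
      (triv π f b').toOpenPartialHomeomorph).trans c' ∈
      IsManifold.maximalAtlas (IX.prod IF) ∞ (X × F) := by
    apply OpenPartialHomeomorph.mem_maximalAtlas_of_contMDiffOn
    · rw [OpenPartialHomeomorph.coe_trans]
      refine (contMDiffOn_of_mem_maximalAtlas mc').comp
        ((contMDiffOn_transition b b').mono ?_) ?_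
      · exact fun p hp => hp.1
      · exact fun p hp => hp.2
    · rw [OpenPartialHomeomorph.coe_trans_symm]
      have h2 := contMDiffOn_transition (π := π) (f := f) b' b
      refine ContMDiffOn.comp (t := ((triv π f b').toOpenPartialHomeomorph.symm.trans
        (triv π f b).toOpenPartialHomeomorph).source) h2
        ((contMDiffOn_symm_of_mem_maximalAtlas mc').mono ?_) ?_
      · exact fun p hp => hp.1
      · exact fun p hp => hp.2
  have := StructureGroupoid.compatible_of_mem_maximalAtlas mc h1
  rwa [OpenPartialHomeomorph.trans_symm_eq_symm_trans_symm, OpenPartialHomeomorph.trans_assoc,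
    ← OpenPartialHomeomorph.trans_assoc _ _ c']

instance : IsManifold (IX.prod IF) ∞ (Pullback π f) where
  compatible := by
    rintro _ _ ⟨b, c, hc, rfl⟩ ⟨b', c', hc', rfl⟩
    exact triv_trans_mem_groupoid hc hc'

theorem contMDiffOn_triv (b : B) :
    ContMDiffOn (IX.prod IF) (IX.prod IF) ∞ (triv π f b).toOpenPartialHomeomorph
      (triv π f b).source := by
  intro z hz
  set p := (triv π f b).toOpenPartialHomeomorph z with hp
  set c := chartAt (ModelProd HX HF) p
  have hmem : (triv π f b).toOpenPartialHomeomorph.trans c ∈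
      IsManifold.maximalAtlas (IX.prod IF) ∞ (Pullback π f) :=
    IsManifold.subset_maximalAtlas ⟨b, c, chart_mem_atlas _ _, rfl⟩
  have hz' : z ∈ ((triv π f b).toOpenPartialHomeomorph.trans c).source :=
    ⟨hz, mem_chart_source (ModelProd HX HF) p⟩
  have h1 := contMDiffAt_of_mem_maximalAtlas hmem hz'
  have h2 : ContMDiffAt (IX.prod IF) (IX.prod IF) ∞ c.symm (c p) :=
    (contMDiffOn_chart_symm (I := IX.prod IF) (n := ∞) (x := p)).contMDiffAt
      (c.open_target.mem_nhds (c.map_source (mem_chart_source _ _)))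
  have h3 := ContMDiffAt.comp z (g := c.symm) h2 h1
  refine (h3.congr_of_eventuallyEq ?_).contMDiffWithinAt
  filter_upwards [((triv π f b).toOpenPartialHomeomorph.trans c).open_source.mem_nhds hz'] with w hw
  exact (c.left_inv hw.2).symm

theorem contMDiffOn_triv_symm (b : B) :
    ContMDiffOn (IX.prod IF) (IX.prod IF) ∞ (triv π f b).toOpenPartialHomeomorph.symm
      (triv π f b).target := by
  intro p hp
  set c := chartAt (ModelProd HX HF) p
  have hmem : (triv π f b).toOpenPartialHomeomorph.trans c ∈
      IsManifold.maximalAtlas (IX.prod IF) ∞ (Pullback π f) :=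
    IsManifold.subset_maximalAtlas ⟨b, c, chart_mem_atlas _ _, rfl⟩
  have h1 : ContMDiffAt (IX.prod IF) (IX.prod IF) ∞ c p :=
    (contMDiffOn_chart (I := IX.prod IF) (n := ∞) (x := p)).contMDiffAt
      (c.open_source.mem_nhds (mem_chart_source _ _))
  have hp' : c p ∈ ((triv π f b).toOpenPartialHomeomorph.trans c).target := by
    rw [OpenPartialHomeomorph.trans_target]
    refine ⟨c.map_source (mem_chart_source _ _), ?_⟩
    rw [Set.mem_preimage, c.left_inv (mem_chart_source _ _)]
    exact hp
  have h2 := (contMDiffOn_symm_of_mem_maximalAtlas hmem).contMDiffAt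
    (((triv π f b).toOpenPartialHomeomorph.trans c).open_target.mem_nhds hp')
  have h3 := ContMDiffAt.comp p (f := c) h2 h1
  refine (h3.congr_of_eventuallyEq ?_).contMDiffWithinAt
  filter_upwards [c.open_source.mem_nhds (mem_chart_source _ _)] with w hw
  change _ = (triv π f b).toOpenPartialHomeomorph.symm (c.symm (c w))
  rw [c.left_inv hw]

theorem contMDiff_base : ContMDiff (IX.prod IF) IX ∞ (base : Pullback π f → X) := by
  intro z
  have h := (contMDiffOn_triv (π := π) (f := f) (f z.base)).contMDiffAt
    ((triv π f (f z.base)).open_source.mem_nhds (π.mem_baseSet _))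
  exact contMDiff_fst.contMDiffAt.comp z h

theorem contMDiff_incl : ContMDiff (IX.prod IF) IY ∞ (incl : Pullback π f → Y) := by
  intro z
  have hz : z ∈ (triv π f (f z.base)).source := π.mem_baseSet _
  have h := (contMDiffOn_triv (π := π) (f := f) (f z.base)).contMDiffAt
    ((triv π f (f z.base)).open_source.mem_nhds hz)
  have h2 : ContMDiffAt (IX.prod IF) (IB.prod IF) ∞
      (fun w : Pullback π f => (f w.base, ((triv π f (f z.base)).toOpenPartialHomeomorph w).2)) z :=
    (f.contMDiff.contMDiffAt.comp z contMDiff_base.contMDiffAt).prodMk (contMDiff_snd.contMDiffAt.comp z h)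
  have h3 : ContMDiffAt (IB.prod IF) IY ∞ (π.trivAt (f z.base)).toOpenPartialHomeomorph.symm
      (f z.base, ((triv π f (f z.base)).toOpenPartialHomeomorph z).2) :=
    (π.contMDiffOn_triv_symm _).contMDiffAt ((π.trivAt _).open_target.mem_nhds
      ((π.trivAt _).mem_target.2 hz))
  refine (ContMDiffAt.comp z h3 h2).congr_of_eventuallyEq ?_
  filter_upwards [(triv π f (f z.base)).open_source.mem_nhds hz] with w hw
  change _ = (π.trivAt (f z.base)).toOpenPartialHomeomorph.symm
    (f w.base, ((π.trivAt (f z.base)) w.incl).2)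
  rw [condition w]
  exact ((π.trivAt _).symm_apply_mk_proj (incl_mem_source hw)).symm

end Pullback

variable [IsManifold IX ∞ X] [IsManifold IF ∞ F]

/-- The pull-back bundle `f^*Y → X`. -/
def SmoothFiberBundle.pullback (π : SmoothFiberBundle IY Y IB B IF F) (f : C^∞⟮IX, X; IB, B⟯) :
    SmoothFiberBundle (IX.prod IF) (Pullback π f) IX X IF F where
  proj := Pullback.base
  contMDiff_proj := Pullback.contMDiff_base
  trivAt x := Pullback.triv π f (f x)
  mem_baseSet x := π.mem_baseSet (f x)
  contMDiffOn_triv x := Pullback.contMDiffOn_triv (f x)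
  contMDiffOn_triv_symm x := Pullback.contMDiffOn_triv_symm (f x)

end Bundle

section Calculus

variable
    {EY : Type*} [NormedAddCommGroup EY] [NormedSpace ℝ EY]
    {HY : Type*} [TopologicalSpace HY] {IY : ModelWithCorners ℝ EY HY}
    {Y : Type*} [TopologicalSpace Y] [ChartedSpace HY Y]
    {EB : Type*} [NormedAddCommGroup EB] [NormedSpace ℝ EB]
    {HB : Type*} [TopologicalSpace HB] {IB : ModelWithCorners ℝ EB HB}
    {B : Type*} [TopologicalSpace B] [ChartedSpace HB B]
    {EF : Type*} [NormedAddCommGroup EF] [NormedSpace ℝ EF]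
    {HF : Type*} [TopologicalSpace HF] {IF : ModelWithCorners ℝ EF HF}
    {F : Type*} [TopologicalSpace F] [ChartedSpace HF F]
    {EX : Type*} [NormedAddCommGroup EX] [NormedSpace ℝ EX]
    {HX : Type*} [TopologicalSpace HX] {IX : ModelWithCorners ℝ EX HX}
    {X : Type*} [TopologicalSpace X] [ChartedSpace HX X]

/-! ### Vertical vectors, first jets, connections -/

variable (IY IB) in
/-- The vertical tangent space `V_y Y = ker (T_y p)` of a map `p : Y → B`. -/
abbrev Vert (p : Y → B) (y : Y) : Submodule ℝ (TangentSpace IY y) :=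
  LinearMap.ker (mfderiv IY IB p y).toLinearMap

variable (IY IB) in
/-- The first-order jets at `x` of sections of `p : Y → B` with value `y` at `x`: a jet is given by
the point `y` over `x` and the linear map `T_x B → T_y Y` (the differential at `x` of any section
representing the jet), which is a right inverse of `T_y p`. -/
structure Jet1 (p : Y → B) (x : B) (y : Y) where
  base : p y = x
  lin : TangentSpace IB x →L[ℝ] TangentSpace IY y
  isSection : ∀ v, tangentCast IB base (mfderiv IY IB p y (lin v)) = v

/-- The first jet `j¹_x s` of a section `s` of `p : Y → B`. -/
def jet1 {p : Y → B} (hp : ContMDiff IY IB ∞ p) (s : C^∞⟮IB, B; IY, Y⟯) (hs : ∀ x, p (s x) = x)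
    (x : B) : Jet1 IY IB p x (s x) where
  base := hs x
  lin := mfderiv IB IY s x
  isSection v := by
    have h := mfderiv_comp_raw (x := x) (y := s x) rfl (hp.mdifferentiable (by simp) (s x))
      (s.contMDiff.mdifferentiable (by simp) x) v
    have e : p ∘ s = id := funext hs
    rw [e, mfderiv_id] at h
    exact (tangentCast_apply IB (hs x) _).trans h.symm

section

variable [IsManifold IY ∞ Y] [IsManifold IB ∞ B]

/-- A connection on a fiber bundle `π : Y → B`: a smooth section `y ↦ A_y` of the jet bundle
`J¹Y → Y`, that is, a smooth splitting `A_y : T_{π y} B → T_y Y` of `T_y π` (in coordinates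
`A = dx^λ ⊗ (∂_λ + A_λ^i(x, y) ∂_i)`). -/
structure Connection (π : SmoothFiberBundle IY Y IB B IF F) where
  toFun : ∀ y : Y, TangentSpace IB (π.proj y) →L[ℝ] TangentSpace IY y
  isSection : ∀ y v, mfderiv IY IB π.proj y (toFun y v) = v
  /-- the matrix of `A_y` in local coordinates depends smoothly on `y` -/
  smooth : ∀ y₀, ContMDiffAt IY 𝓘(ℝ, EB →L[ℝ] EY) ∞
    (inTangentCoordinates IB IY π.proj id toFun y₀) y₀

/-- The covariant differential `D^A : J¹Y → T^*B ⊗ VY` of a connection `A` on `π : Y → B`,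
`D^A(Γ) = Γ - A_y`, in coordinates `dx^λ ⊗ (y^i_λ - A^i_λ) ∂_i`. -/
def covariantDifferential {π : SmoothFiberBundle IY Y IB B IF F} (A : Connection π)
    {x : B} {y : Y} (Γ : Jet1 IY IB π.proj x y) :
    TangentSpace IB x →L[ℝ] Vert IY IB π.proj y :=
  (Γ.lin - A.toFun y ∘L tangentCast IB Γ.base.symm).codRestrict (Vert IY IB π.proj y) (by
    intro v
    obtain ⟨h, Γ, hΓ⟩ := Γ
    subst h
    have h1 : mfderiv IY IB π.proj y (Γ v) = v := hΓ v
    simp only [LinearMap.mem_ker, ContinuousLinearMap.coe_coe]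
    change mfderiv IY IB π.proj y (Γ v - A.toFun y v) = 0
    rw [map_sub, h1, A.isSection, sub_self])

/-- The vertical covariant differential `D̃ : J¹Y → T^*X ⊗ V_Σ Y` on a composite bundle
`Y → Σ → X` (here `Σ` is `B`), determined by a connection `A` on `π : Y → Σ`. It sends a jet `Γ` of
sections of `Y → X` at `y` to `Γ - A_y ∘ (T_y π ∘ Γ)`, where `T_y π ∘ Γ` is the jet of sections of
`Σ → X` to which `Γ` projects; in coordinates this is
`dx^λ ⊗ (y^i_λ - A^i_λ - A^i_m σ^m_λ) ∂_i`. -/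
def verticalCovariantDifferential {π : SmoothFiberBundle IY Y IB B IF F} (A : Connection π)
    {ρ : B → X} {x : X} {y : Y} (Γ : Jet1 IY IX (ρ ∘ π.proj) x y) :
    TangentSpace IX x →L[ℝ] Vert IY IB π.proj y :=
  (Γ.lin - A.toFun y ∘L mfderiv IY IB π.proj y ∘L Γ.lin).codRestrict (Vert IY IB π.proj y) (by
    intro v
    simp only [LinearMap.mem_ker, ContinuousLinearMap.coe_coe]
    change mfderiv IY IB π.proj y
      (Γ.lin v - A.toFun y (mfderiv IY IB π.proj y (Γ.lin v))) = 0
    rw [map_sub, A.isSection, sub_self])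

end

/-! ### The tangent spaces of a pull-back bundle -/

namespace Pullback

variable {π : SmoothFiberBundle IY Y IB B IF F} {f : C^∞⟮IX, X; IB, B⟯}
  [IsManifold IX ∞ X] [IsManifold IF ∞ F]

theorem mdifferentiable_base : MDifferentiable (IX.prod IF) IX (base : Pullback π f → X) :=
  contMDiff_base.mdifferentiable (by simp)

theorem mdifferentiable_incl : MDifferentiable (IX.prod IF) IY (incl : Pullback π f → Y) :=
  contMDiff_incl.mdifferentiable (by simp)

/-- `Tf (T base w) = Tπ (T incl w)`. -/
theorem mfderiv_condition (z : Pullback π f) (w : TangentSpace (IX.prod IF) z) :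
    tangentCast IB z.condition (mfderiv IX IB f z.base (mfderiv (IX.prod IF) IX base z w)) =
      mfderiv IY IB π.proj z.incl (mfderiv (IX.prod IF) IY incl z w) := by
  have h1 := mfderiv_comp_raw (x := z) (y := z.base) rfl
    (f.contMDiff.mdifferentiable (by simp) _) (mdifferentiable_base z) w
  have h2 := mfderiv_comp_raw (x := z) (y := z.incl) rfl
    (π.contMDiff_proj.mdifferentiable (by simp) _) (mdifferentiable_incl z) w
  have e : (f ∘ base : Pullback π f → B) = π.proj ∘ incl := funext condition
  rw [e] at h1
  exact (tangentCast_apply IB _ _).trans (h1.symm.trans h2)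

/-- The `F`-component of the local trivialization around `b`. -/
def snd (π : SmoothFiberBundle IY Y IB B IF F) (b : B) (y : Y) : F := ((π.trivAt b) y).2

theorem contMDiffAt_snd_triv {b : B} {y : Y} (hy : y ∈ (π.trivAt b).source) :
    ContMDiffAt IY IF ∞ (snd π b) y :=
  contMDiff_snd.contMDiffAt.comp y
    ((π.contMDiffOn_triv b).contMDiffAt ((π.trivAt b).open_source.mem_nhds hy))

theorem triv_symm_triv {b : B} {z : Pullback π f} (hz : z ∈ (triv π f b).source) :
    (triv π f b).toOpenPartialHomeomorph.symm (z.base, snd π b z.incl) = z :=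
  (triv π f b).toOpenPartialHomeomorph.left_inv hz

theorem contMDiffAt_triv_symm {b : B} {z : Pullback π f} (hz : z ∈ (triv π f b).source) :
    ContMDiffAt (IX.prod IF) (IX.prod IF) ∞ (triv π f b).toOpenPartialHomeomorph.symm
      (z.base, snd π b z.incl) :=
  (contMDiffOn_triv_symm b).contMDiffAt ((triv π f b).open_target.mem_nhds
    ((triv π f b).map_source hz))

/-- The tangent vector of `f^*Y` given in the local trivialization around `b` by a vector of `X` and
a vector of `F`. -/
def lift (b : B) (z : Pullback π f) (w : EX × EF) : EX × EF :=
  (mfderiv (IX.prod IF) (IX.prod IF) (triv π f b).toOpenPartialHomeomorph.symm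
    (z.base, snd π b z.incl) : EX × EF →L[ℝ] EX × EF) w

theorem mfderiv_base_lift {b : B} {z : Pullback π f} (hz : z ∈ (triv π f b).source)
    (w : EX × EF) :
    (mfderiv (IX.prod IF) IX base z : EX × EF →L[ℝ] EX) (lift (IX := IX) (IF := IF) b z w) =
      w.1 := by
  have h := mfderiv_comp_raw (triv_symm_triv hz) (mdifferentiable_base z)
    ((contMDiffAt_triv_symm hz).mdifferentiableAt (by simp)) w
  refine h.symm.trans ?_
  have e : base ∘ (triv π f b).toOpenPartialHomeomorph.symm =ᶠ[𝓝 (z.base, snd π b z.incl)]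
      Prod.fst := by
    filter_upwards [(triv π f b).open_target.mem_nhds ((triv π f b).map_source hz)] with p hp
    exact base_triv_symm (mem_triv_target.1 hp)
  rw [e.mfderiv_eq, mfderiv_fst]; rfl

theorem lift_mfderiv {b : B} {z : Pullback π f} (hz : z ∈ (triv π f b).source) (w : EX × EF) :
    lift (IX := IX) (IF := IF) b z ((mfderiv (IX.prod IF) IX base z : EX × EF →L[ℝ] EX) w,
      (mfderiv IY IF (snd π b) z.incl : EY →L[ℝ] EF)
        ((mfderiv (IX.prod IF) IY incl z : EX × EF →L[ℝ] EY) w)) = w := by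
  have hs := (contMDiffAt_snd_triv (incl_mem_source hz)).mdifferentiableAt (n := ∞) (by simp)
  have hsi : MDifferentiableAt (IX.prod IF) IF (fun z : Pullback π f => snd π b z.incl) z :=
    MDifferentiableAt.comp (g := snd π b) z hs (mdifferentiable_incl z)
  have h1 := mfderiv_comp_raw (x := z) (y := z.incl) rfl hs (mdifferentiable_incl z) w
  have h2 : (mfderiv (IX.prod IF) (IX.prod IF)
      (fun z : Pullback π f => (z.base, snd π b z.incl)) z : EX × EF →L[ℝ] EX × EF) w =
      ((mfderiv (IX.prod IF) IX base z : EX × EF →L[ℝ] EX) w,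
      (mfderiv IY IF (snd π b) z.incl : EY →L[ℝ] EF)
        ((mfderiv (IX.prod IF) IY incl z : EX × EF →L[ℝ] EY) w)) := by
    rw [← h1]
    exact mfderiv_prodMk_raw (mdifferentiable_base z) hsi w
  refine (congrArg (lift b z) h2.symm).trans ?_
  have h3 := mfderiv_comp_raw (f := fun z : Pullback π f => (z.base, snd π b z.incl)) (x := z) rfl
    ((contMDiffAt_triv_symm hz).mdifferentiableAt (n := ∞) (by simp))
    ((mdifferentiable_base z).prodMk hsi) w
  refine h3.symm.trans ?_
  have e : (triv π f b).toOpenPartialHomeomorph.symm ∘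
      (fun z : Pullback π f => (z.base, snd π b z.incl)) =ᶠ[𝓝 z] id := by
    filter_upwards [(triv π f b).open_source.mem_nhds hz] with p hp
    exact triv_symm_triv hp
  rw [e.mfderiv_eq, mfderiv_id]; rfl

theorem mfderiv_incl_lift {b : B} {z : Pullback π f} (hz : z ∈ (triv π f b).source)
    (v : EX) (w : EY) (hvw : (mfderiv IX IB f z.base : EX →L[ℝ] EB) v =
      (mfderiv IY IB π.proj z.incl : EY →L[ℝ] EB) w) :
    (mfderiv (IX.prod IF) IY incl z : EX × EF →L[ℝ] EY) (lift (IX := IX) (IF := IF) b z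
      (v, (mfderiv IY IF (snd π b) z.incl : EY →L[ℝ] EF) w)) = w := by
  have hs := (contMDiffAt_snd_triv (incl_mem_source hz)).mdifferentiableAt (n := ∞) (by simp)
  have hπ := π.contMDiff_proj.mdifferentiable (n := ∞) (by simp) z.incl
  have hf := f.contMDiff.mdifferentiable (n := ∞) (by simp) z.base
  -- `e.symm` is the inverse of `(π, snd)` near `z.incl`
  have he : MDifferentiableAt (IB.prod IF) IY (π.trivAt b).toOpenPartialHomeomorph.symm
      (π.proj z.incl, snd π b z.incl) :=
    ((π.contMDiffOn_triv_symm b).contMDiffAt ((π.trivAt b).open_target.mem_nhds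
      ((π.trivAt b).mem_target.2 ((π.trivAt b).mem_source.1 (incl_mem_source hz))))
      ).mdifferentiableAt (by simp)
  set u : EF := (mfderiv IY IF (snd π b) z.incl : EY →L[ℝ] EF) w with hu
  have h1 := mfderiv_comp_raw (triv_symm_triv hz) (mdifferentiable_incl z)
    ((contMDiffAt_triv_symm hz).mdifferentiableAt (n := ∞) (by simp)) (v, u)
  refine h1.symm.trans ?_
  have e1 : incl ∘ (triv π f b).toOpenPartialHomeomorph.symm =ᶠ[𝓝 (z.base, snd π b z.incl)]
      (π.trivAt b).toOpenPartialHomeomorph.symm ∘ Prod.map f id := by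
    filter_upwards [(triv π f b).open_target.mem_nhds ((triv π f b).map_source hz)] with p hp
    exact incl_triv_symm (mem_triv_target.1 hp)
  rw [e1.mfderiv_eq]
  have h2 := mfderiv_comp_raw (f := Prod.map f id) (x := (z.base, snd π b z.incl))
    (y := (π.proj z.incl, snd π b z.incl)) (Prod.ext z.condition rfl) he (MDifferentiableAt.prodMap (x := z.base) (y := snd π b z.incl) hf mdifferentiableAt_id) (v, u)
  refine h2.trans ?_
  have h3 := mfderiv_comp_raw (f := fun y => (π.proj y, snd π b y)) (x := z.incl) rfl he
    (hπ.prodMk hs) w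
  have e2 : (π.trivAt b).toOpenPartialHomeomorph.symm ∘ (fun y => (π.proj y, snd π b y))
      =ᶠ[𝓝 z.incl] id := by
    filter_upwards [(π.trivAt b).open_source.mem_nhds (incl_mem_source hz)] with y hy
    exact (π.trivAt b).symm_apply_mk_proj hy
  rw [e2.mfderiv_eq, mfderiv_id, mfderiv_prodMk hπ hs] at h3
  rw [mfderiv_prodMap (p := (z.base, snd π b z.incl)) hf mdifferentiableAt_id, mfderiv_id]
  refine Eq.trans ?_ h3.symm
  congr 1
  exact Prod.ext hvw hu

/-- A tangent vector of `f^*Y` is determined by its images in `TX` and `TY`. -/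
theorem tangent_ext (z : Pullback π f) {w w' : TangentSpace (IX.prod IF) z}
    (h1 : mfderiv (IX.prod IF) IX base z w = mfderiv (IX.prod IF) IX base z w')
    (h2 : mfderiv (IX.prod IF) IY incl z w = mfderiv (IX.prod IF) IY incl z w') : w = w' := by
  have hz : z ∈ (triv π f (f z.base)).source := π.mem_baseSet _
  have e1 := lift_mfderiv (IX := IX) (IF := IF) hz w
  have e2 := lift_mfderiv (IX := IX) (IF := IF) hz w'
  rw [← e1, ← e2]
  exact congrArg (lift _ z) (Prod.ext h1 (congrArg (mfderiv IY IF (snd π _) z.incl) h2))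


theorem lift_eq {b : B} {z : Pullback π f} (hz : z ∈ (triv π f b).source) (v : EX) (u : EF) :
    lift (IX := IX) (IF := IF) b z (v, u) =
      (mfderiv IX (IX.prod IF) (fun x => (triv π f b).toOpenPartialHomeomorph.symm
        (x, snd π b z.incl)) z.base : EX →L[ℝ] EX × EF) v +
      (mfderiv IF (IX.prod IF) (fun u => (triv π f b).toOpenPartialHomeomorph.symm
        (z.base, u)) (snd π b z.incl) : EF →L[ℝ] EX × EF) u :=
  mfderiv_prod_eq_add_apply ((contMDiffAt_triv_symm hz).mdifferentiableAt (n := ∞) (by simp))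

/-- The canonical isomorphism `V_z(f^*Y) ≅ V_{incl z} Y` of vertical tangent spaces, given by the
tangent map of `incl : f^*Y → Y`. -/
def vertEquiv (z : Pullback π f) :
    Vert (IX.prod IF) IX (π.pullback f).proj z ≃L[ℝ] Vert IY IB π.proj z.incl :=
  ContinuousLinearEquiv.equivOfInverse
    ((mfderiv (IX.prod IF) IY incl z ∘L Submodule.subtypeL _).codRestrict _ (by
      rintro ⟨w, hw⟩
      have hw' : mfderiv (IX.prod IF) IX base z w = 0 := hw
      have h := mfderiv_condition z w
      rw [hw', map_zero, map_zero] at h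
      exact h.symm))
    (((mfderiv (IX.prod IF) (IX.prod IF) (triv π f (f z.base)).toOpenPartialHomeomorph.symm
      (z.base, snd π (f z.base) z.incl) : EX × EF →L[ℝ] EX × EF) ∘L
      ContinuousLinearMap.inr ℝ EX EF ∘L
      (mfderiv IY IF (snd π (f z.base)) z.incl : EY →L[ℝ] EF) ∘L
      Submodule.subtypeL (Vert IY IB π.proj z.incl)).codRestrict _ (by
        rintro ⟨w, hw⟩
        exact mfderiv_base_lift (π.mem_baseSet (f z.base)) _))
    (by
      rintro ⟨w, hw⟩
      apply Subtype.ext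
      have hw' : mfderiv (IX.prod IF) IX base z w = 0 := hw
      have h := lift_mfderiv (IX := IX) (IF := IF) (π.mem_baseSet (f z.base)) w
      have hp : ((0 : EX), (mfderiv IY IF (snd π (f z.base)) z.incl : EY →L[ℝ] EF)
          ((mfderiv (IX.prod IF) IY incl z : EX × EF →L[ℝ] EY) w)) =
          ((mfderiv (IX.prod IF) IX base z : EX × EF →L[ℝ] EX) w,
          (mfderiv IY IF (snd π (f z.base)) z.incl : EY →L[ℝ] EF)
          ((mfderiv (IX.prod IF) IY incl z : EX × EF →L[ℝ] EY) w)) := Prod.ext hw'.symm rfl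
      exact Eq.trans (congrArg (lift _ z) hp) h)
    (by
      rintro ⟨w, hw⟩
      apply Subtype.ext
      have hw' : mfderiv IY IB π.proj z.incl w = 0 := hw
      exact mfderiv_incl_lift (IX := IX) (IF := IF) (π.mem_baseSet (f z.base)) 0 w
        ((map_zero (mfderiv IX IB f z.base)).trans hw'.symm))

theorem vertEquiv_apply (z : Pullback π f) (w : Vert (IX.prod IF) IX (π.pullback f).proj z) :
    (vertEquiv z w : TangentSpace IY z.incl) = mfderiv (IX.prod IF) IY incl z w := rfl

variable [IsManifold IY ∞ Y] [IsManifold IB ∞ B]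

/-- The horizontal lift of the pull-back connection, in the local trivialization around `b`. -/
def horLift (A : Connection π) (b : B) (z : Pullback π f) : EX →L[ℝ] EX × EF :=
  (mfderiv IX (IX.prod IF) (fun x => (triv π f b).toOpenPartialHomeomorph.symm
    (x, snd π b z.incl)) z.base : EX →L[ℝ] EX × EF) +
  (mfderiv IF (IX.prod IF) (fun u => (triv π f b).toOpenPartialHomeomorph.symm
    (z.base, u)) (snd π b z.incl) : EF →L[ℝ] EX × EF) ∘L
  (mfderiv IY IF (snd π b) z.incl : EY →L[ℝ] EF) ∘L
  (A.toFun z.incl : EB →L[ℝ] EY) ∘L (mfderiv IX IB f z.base : EX →L[ℝ] EB)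

theorem horLift_eq (A : Connection π) {b : B} {z : Pullback π f} (hz : z ∈ (triv π f b).source)
    (v : EX) : horLift A b z v = lift (IX := IX) (IF := IF) b z (v,
      (mfderiv IY IF (snd π b) z.incl : EY →L[ℝ] EF)
      ((A.toFun z.incl : EB →L[ℝ] EY) ((mfderiv IX IB f z.base : EX →L[ℝ] EB) v))) :=
  (lift_eq hz _ _).symm

theorem mfderiv_base_horLift (A : Connection π) {b : B} {z : Pullback π f}
    (hz : z ∈ (triv π f b).source) (v : TangentSpace IX z.base) :
    mfderiv (IX.prod IF) IX base z (horLift A b z v) = v :=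
  (congrArg (mfderiv (IX.prod IF) IX base z) (horLift_eq A hz v)).trans (mfderiv_base_lift hz _)

theorem mfderiv_incl_horLift (A : Connection π) {b : B} {z : Pullback π f}
    (hz : z ∈ (triv π f b).source) (v : TangentSpace IX z.base) :
    mfderiv (IX.prod IF) IY incl z (horLift A b z v) =
      A.toFun z.incl (tangentCast IB z.condition (mfderiv IX IB f z.base v)) := by
  refine (congrArg (mfderiv (IX.prod IF) IY incl z) (horLift_eq A hz v)).trans
    ((mfderiv_incl_lift hz _ _ ?_).trans ?_)
  · exact (A.isSection z.incl _).symm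
  · exact congrArg (A.toFun z.incl) (tangentCast_apply IB z.condition _).symm

theorem smooth_horLift (A : Connection π) {b : B} {z₀ : Pullback π f}
    (hz : z₀ ∈ (triv π f b).source) : ContMDiffAt (IX.prod IF) 𝓘(ℝ, EX →L[ℝ] EX × EF) ∞
      (inTangentCoordinates IX (IX.prod IF) base id (horLift A b) z₀) z₀ := by
  have hi := contMDiff_incl (π := π) (f := f) z₀
  have hb := contMDiff_base (π := π) (f := f) z₀
  have hs := contMDiffAt_snd_triv (incl_mem_source hz)
  have hsi : ContMDiffAt (IX.prod IF) IF ∞ (fun z : Pullback π f => snd π b z.incl) z₀ :=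
    ContMDiffAt.comp (g := snd π b) z₀ hs hi
  have ht := contMDiffAt_triv_symm hz
  have hid : (fun z : Pullback π f => (triv π f b).toOpenPartialHomeomorph.symm
      (z.base, snd π b z.incl)) =ᶠ[𝓝 z₀] id := by
    filter_upwards [(triv π f b).open_source.mem_nhds hz] with p hp
    exact triv_symm_triv hp
  have hcond : (fun z : Pullback π f => f z.base) = fun z => π.proj z.incl := funext condition
  have hJ : ContMDiffAt (IX.prod IF) 𝓘(ℝ, EX →L[ℝ] EX × EF) ∞
      (inTangentCoordinates IX (IX.prod IF) base id (fun z : Pullback π f =>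
        (mfderiv IX (IX.prod IF) (fun x => (triv π f b).toOpenPartialHomeomorph.symm
          (x, snd π b z.incl)) z.base : EX →L[ℝ] EX × EF)) z₀) z₀ := by
    have h := ContMDiffAt.mfderiv (m := ∞) (n := ∞) (x₀ := z₀) (I := IX) (I' := IX.prod IF)
      (fun (z : Pullback π f) (x : X) => (triv π f b).toOpenPartialHomeomorph.symm
        (x, snd π b z.incl)) base
      (ContMDiffAt.comp (g := (triv π f b).toOpenPartialHomeomorph.symm) (z₀, z₀.base) ht
        (contMDiff_snd.contMDiffAt.prodMk
          (ContMDiffAt.comp (g := fun z : Pullback π f => snd π b z.incl) (z₀, z₀.base) hsi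
            contMDiff_fst.contMDiffAt))) hb (by simp)
    exact h.congr_of_eventuallyEq
      (inTangentCoordinates_congr Filter.EventuallyEq.rfl hid.symm Filter.EventuallyEq.rfl)
  have hK : ContMDiffAt (IX.prod IF) 𝓘(ℝ, EF →L[ℝ] EX × EF) ∞
      (inTangentCoordinates IF (IX.prod IF) (fun z : Pullback π f => snd π b z.incl) id
        (fun z : Pullback π f => (mfderiv IF (IX.prod IF)
          (fun u => (triv π f b).toOpenPartialHomeomorph.symm
          (z.base, u)) (snd π b z.incl) : EF →L[ℝ] EX × EF)) z₀) z₀ := by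
    have h := ContMDiffAt.mfderiv (m := ∞) (n := ∞) (x₀ := z₀) (I := IF) (I' := IX.prod IF)
      (fun (z : Pullback π f) (u : F) => (triv π f b).toOpenPartialHomeomorph.symm
        (z.base, u)) (fun z : Pullback π f => snd π b z.incl)
      (ContMDiffAt.comp (g := (triv π f b).toOpenPartialHomeomorph.symm)
        (z₀, snd π b z₀.incl) ht
        ((ContMDiffAt.comp (g := (base : Pullback π f → X)) (z₀, snd π b z₀.incl) hb
            contMDiff_fst.contMDiffAt).prodMk contMDiff_snd.contMDiffAt)) hsi (by simp)
    exact h.congr_of_eventuallyEq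
      (inTangentCoordinates_congr Filter.EventuallyEq.rfl hid.symm Filter.EventuallyEq.rfl)
  have hE : ContMDiffAt (IX.prod IF) 𝓘(ℝ, EY →L[ℝ] EF) ∞
      (inTangentCoordinates IY IF (fun z : Pullback π f => z.incl)
        (fun z : Pullback π f => snd π b z.incl)
        (fun z : Pullback π f => (mfderiv IY IF (snd π b) z.incl : EY →L[ℝ] EF)) z₀) z₀ :=
    ContMDiffAt.mfderiv (m := ∞) (n := ∞) (x₀ := z₀) (I := IY) (I' := IF)
      (fun _ => snd π b) incl
      (ContMDiffAt.comp (g := snd π b) (z₀, z₀.incl) hs contMDiff_snd.contMDiffAt) hi (by simp)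
  have hA : ContMDiffAt (IX.prod IF) 𝓘(ℝ, EB →L[ℝ] EY) ∞
      (inTangentCoordinates IB IY (fun z : Pullback π f => π.proj z.incl)
        (fun z : Pullback π f => z.incl)
        (fun z : Pullback π f => (A.toFun z.incl : EB →L[ℝ] EY)) z₀) z₀ :=
    ContMDiffAt.comp (g := inTangentCoordinates IB IY π.proj id A.toFun z₀.incl) z₀
      (A.smooth z₀.incl) hi
  have hf : ContMDiffAt (IX.prod IF) 𝓘(ℝ, EX →L[ℝ] EB) ∞
      (inTangentCoordinates IX IB (fun z : Pullback π f => z.base)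
        (fun z : Pullback π f => f z.base)
        (fun z : Pullback π f => (mfderiv IX IB f z.base : EX →L[ℝ] EB)) z₀) z₀ :=
    ContMDiffAt.mfderiv (m := ∞) (n := ∞) (x₀ := z₀) (I := IX) (I' := IB)
      (fun _ => f) base
      (ContMDiffAt.comp (g := f) (z₀, z₀.base) f.contMDiff.contMDiffAt
        contMDiff_snd.contMDiffAt) hb (by simp)
  rw [hcond] at hf
  exact inTangentCoordinates_add hJ (inTangentCoordinates_comp hK
    (inTangentCoordinates_comp hE (inTangentCoordinates_comp hA hf
      (π.contMDiff_proj.continuous.comp continuous_incl).continuousAt)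
      continuous_incl.continuousAt) hsi.continuousAt)

theorem exists_pullback_connection (A : Connection π) (f : C^∞⟮IX, X; IB, B⟯) :
    ∃ A' : Connection (π.pullback f), ∀ (z : Pullback π f) (v : TangentSpace IX z.base),
      mfderiv (IX.prod IF) IY incl z (A'.toFun z v) =
        A.toFun z.incl (tangentCast IB z.condition (mfderiv IX IB f z.base v)) := by
  refine ⟨⟨fun z => (horLift A (f z.base) z : EX →L[ℝ] EX × EF), fun z v => ?_, fun z₀ => ?_⟩, fun z v => ?_⟩
  · exact mfderiv_base_horLift A (π.mem_baseSet _) v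
  · have hz₀ : z₀ ∈ (triv π f (f z₀.base)).source := π.mem_baseSet _
    refine (smooth_horLift A hz₀).congr_of_eventuallyEq (inTangentCoordinates_congr
      Filter.EventuallyEq.rfl Filter.EventuallyEq.rfl ?_)
    filter_upwards [(triv π f (f z₀.base)).open_source.mem_nhds hz₀] with z hz
    refine ContinuousLinearMap.ext fun v => ?_
    have hz' : z ∈ (triv π f (f z.base)).source := π.mem_baseSet _
    exact tangent_ext z
      ((mfderiv_base_horLift A hz' v).trans (mfderiv_base_horLift A hz v).symm)
      ((mfderiv_incl_horLift A hz' v).trans (mfderiv_incl_horLift A hz v).symm)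
  · exact mfderiv_incl_horLift A (π.mem_baseSet _) v

end Pullback

variable {π : SmoothFiberBundle IY Y IB B IF F}
  [IsManifold IX ∞ X] [IsManifold IF ∞ F] [IsManifold IY ∞ Y] [IsManifold IB ∞ B]

/-- The pull-back connection `f^*A` on `f^*Y → X`: the unique connection (see
`Connection.pullback_unique`) whose horizontal lifts are mapped by `T incl : T(f^*Y) → TY` to the
horizontal lifts of `A`, that is, `T incl ∘ (f^*A)_z = A_{incl z} ∘ Tf`. In coordinates
`dx^λ ⊗ [∂_λ + (A^i_m(x, f(x), y) ∂_λ f^m + A^i_λ(x, f(x), y)) ∂_i]`, if `f` is a section of a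
bundle over `X`. -/
def Connection.pullback (A : Connection π) (f : C^∞⟮IX, X; IB, B⟯) : Connection (π.pullback f) :=
  (Pullback.exists_pullback_connection A f).choose

theorem Connection.pullback_spec (A : Connection π) (f : C^∞⟮IX, X; IB, B⟯) (z : Pullback π f)
    (v : TangentSpace IX z.base) :
    mfderiv (IX.prod IF) IY Pullback.incl z ((A.pullback f).toFun z v) =
      A.toFun z.incl (tangentCast IB z.condition (mfderiv IX IB f z.base v)) :=
  (Pullback.exists_pullback_connection A f).choose_spec z v

theorem Connection.pullback_unique (A : Connection π) (f : C^∞⟮IX, X; IB, B⟯)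
    (A' : Connection (π.pullback f))
    (h : ∀ (z : Pullback π f) (v : TangentSpace IX z.base),
      mfderiv (IX.prod IF) IY Pullback.incl z (A'.toFun z v) =
        A.toFun z.incl (tangentCast IB z.condition (mfderiv IX IB f z.base v)))
    (z : Pullback π f) : A'.toFun z = (A.pullback f).toFun z := by
  refine ContinuousLinearMap.ext fun v => ?_
  exact Pullback.tangent_ext z ((A'.isSection z v).trans ((A.pullback f).isSection z v).symm)
    ((h z v).trans (A.pullback_spec f z v).symm)

/-! ### Restriction of jets and sections to `Y^h = h^*Y` -/

section Composite

variable {EW : Type*} [NormedAddCommGroup EW] [NormedSpace ℝ EW]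
    {HW : Type*} [TopologicalSpace HW] {IW : ModelWithCorners ℝ EW HW}
    {W : Type*} [TopologicalSpace W] [ChartedSpace HW W]
    (ρ : SmoothFiberBundle IB B IX X IW W)

theorem contMDiff_composite : ContMDiff IY IX ∞ (ρ.proj ∘ π.proj) :=
  ρ.contMDiff_proj.comp π.contMDiff_proj

variable {ρ} {h : C^∞⟮IX, X; IB, B⟯}

theorem composite_incl (hh : ∀ x, ρ.proj (h x) = x) (z : Pullback π h) : (ρ.proj ∘ π.proj) z.incl = z.base := by
  rw [Function.comp, ← z.condition, hh]

/-- The jet prolongation `J¹Y^h → J¹Y` of the canonical inclusion `Y^h → Y` over `X`. -/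
def jetIncl (hh : ∀ x, ρ.proj (h x) = x) {x : X} {z : Pullback π h}
    (Γ : Jet1 (IX.prod IF) IX (π.pullback h).proj x z) :
    Jet1 IY IX (ρ.proj ∘ π.proj) x z.incl where
  base := (composite_incl hh z).trans Γ.base
  lin := mfderiv (IX.prod IF) IY Pullback.incl z ∘L Γ.lin
  isSection v := by
    have h1 := mfderiv_comp_raw (x := z) (y := z.incl) rfl
      ((contMDiff_composite (π := π) ρ).mdifferentiable (by simp) _)
      (Pullback.mdifferentiable_incl z) (Γ.lin v)
    have e : (ρ.proj ∘ π.proj) ∘ (Pullback.incl : Pullback π h → Y) = Pullback.base :=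
      funext (composite_incl hh)
    rw [e] at h1
    have h2 := (tangentCast_apply IX Γ.base _).symm.trans (Γ.isSection v)
    exact (tangentCast_apply IX _ _).trans (h1.symm.trans h2)

/-- A section of `Y^h → X`, viewed as a section of the composite bundle `Y → X`. -/
def sectionIncl (s : C^∞⟮IX, X; IX.prod IF, Pullback π h⟯) : C^∞⟮IX, X; IY, Y⟯ :=
  ⟨fun x => (s x).incl, Pullback.contMDiff_incl.comp s.contMDiff⟩

theorem composite_sectionIncl (hh : ∀ x, ρ.proj (h x) = x)
    (s : C^∞⟮IX, X; IX.prod IF, Pullback π h⟯)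
    (hs : ∀ x, (π.pullback h).proj (s x) = x) (x : X) : (ρ.proj ∘ π.proj) (sectionIncl s x) = x :=
  (composite_incl hh (s x)).trans (hs x)

end Composite

end Calculus

end CompositeBundle

end

open CompositeBundle

/-! ### Comparison of the two covariant differentials on jets -/

namespace CompositeBundle

variable
    {EY : Type*} [NormedAddCommGroup EY] [NormedSpace ℝ EY]
    {HY : Type*} [TopologicalSpace HY] {IY : ModelWithCorners ℝ EY HY}
    {Y : Type*} [TopologicalSpace Y] [ChartedSpace HY Y] [IsManifold IY ∞ Y]
    {EB : Type*} [NormedAddCommGroup EB] [NormedSpace ℝ EB]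
    {HB : Type*} [TopologicalSpace HB] {IB : ModelWithCorners ℝ EB HB}
    {B : Type*} [TopologicalSpace B] [ChartedSpace HB B] [IsManifold IB ∞ B]
    {EF : Type*} [NormedAddCommGroup EF] [NormedSpace ℝ EF]
    {HF : Type*} [TopologicalSpace HF] {IF : ModelWithCorners ℝ EF HF}
    {F : Type*} [TopologicalSpace F] [ChartedSpace HF F] [IsManifold IF ∞ F]
    {EX : Type*} [NormedAddCommGroup EX] [NormedSpace ℝ EX]
    {HX : Type*} [TopologicalSpace HX] {IX : ModelWithCorners ℝ EX HX}
    {X : Type*} [TopologicalSpace X] [ChartedSpace HX X] [IsManifold IX ∞ X]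
    {EW : Type*} [NormedAddCommGroup EW] [NormedSpace ℝ EW]
    {HW : Type*} [TopologicalSpace HW] {IW : ModelWithCorners ℝ EW HW}
    {W : Type*} [TopologicalSpace W] [ChartedSpace HW W]
    {π : SmoothFiberBundle IY Y IB B IF F} {ρ : SmoothFiberBundle IB B IX X IW W}
    {h : C^∞⟮IX, X; IB, B⟯}

/-! The statement is pointwise and reduces to linear algebra in one tangent space of `Y`. Write `i`
for the inclusion of `Y^h` into `Y`. A jet `Γ` at `z`, viewed in `Y`, is `Ti ∘ Γ`, so by definition
its vertical covariant differential is `Ti ∘ Γ - A ∘ Tπ ∘ Ti ∘ Γ`. Only the second term needs work.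

Two facts identify it. Differentiating the equation `h ∘ base = π ∘ i` that defines the pull-back,
and using that `Γ` is a right inverse of `T base`, gives `Tπ ∘ Ti ∘ Γ = Th`: the jet in `Σ`
underlying a jet of `Y^h` is always the jet of `h`, whatever `Γ` is (`mfderiv_proj_incl_jet`). The
characterization of the pull-back connection, `A ∘ Th = Ti ∘ A_h` (`Connection.pullback_spec`), then
turns the second term into `Ti ∘ A_h`. By linearity of `Ti` the difference is `Ti ∘ (Γ - A_h)`, and
`vertEquiv` is precisely `Ti` on vertical vectors.

In coordinates this is the substitution `σ^m_λ = ∂_λ h^m` in `y^i_λ - A^i_λ - A^i_m σ^m_λ`.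

For sections nothing new happens beyond the chain rule `T(i ∘ s) = Ti ∘ Ts`, which says that the
inclusion of jets carries the jet of `s` to the jet of `i ∘ s` (`jet1_sectionIncl`). -/

/-- `Tπ ∘ T incl ∘ Γ = Th` for every jet `Γ` of sections of the pull-back bundle. -/
theorem mfderiv_proj_incl_jet {z : Pullback π h}
    (Γ : Jet1 (IX.prod IF) IX (π.pullback h).proj z.base z) (v : TangentSpace IX z.base) :
    mfderiv IY IB π.proj z.incl (mfderiv (IX.prod IF) IY Pullback.incl z (Γ.lin v)) =
      tangentCast IB z.condition (mfderiv IX IB h z.base v) := by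
  -- With the base point of the jet taken to be `z.base` itself, the cast in `Γ.isSection` is along
  -- a proof of `z.base = z.base`, hence is the identity by definition.
  have hv : mfderiv (IX.prod IF) IX Pullback.base z (Γ.lin v) = v := Γ.isSection v
  -- The differentiated pull-back condition exchanges `Tπ ∘ T incl` for `Th ∘ T base`, and `T base`
  -- undoes `Γ`.
  rw [← Pullback.mfderiv_condition, hv]

/-- The vertical covariant differential restricts along the canonical inclusion to the covariant
differential of the pull-back connection. -/
theorem verticalCovariantDifferential_jetIncl (A : Connection π) (hh : ∀ x, ρ.proj (h x) = x)
    {x : X} {z : Pullback π h} (Γ : Jet1 (IX.prod IF) IX (π.pullback h).proj x z)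
    (v : TangentSpace IX x) :
    verticalCovariantDifferential A (jetIncl hh Γ) v =
      Pullback.vertEquiv z (covariantDifferential (A.pullback h) Γ v) := by
  -- The point `x` carries no freedom, since a jet at `z` lies over `z.base`. Eliminating it makes
  -- the cast inside `covariantDifferential` the identity by definition, which the `change` below
  -- relies on.
  obtain rfl : z.base = x := Γ.base
  -- Vertical vectors of `Y` over `Σ` are compared as vectors of the whole tangent space at
  -- `z.incl`, where the subtractions can be written out.
  apply Subtype.ext
  rw [Pullback.vertEquiv_apply]
  change mfderiv (IX.prod IF) IY Pullback.incl z (Γ.lin v) - A.toFun z.incl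
      (mfderiv IY IB π.proj z.incl (mfderiv (IX.prod IF) IY Pullback.incl z (Γ.lin v))) =
    mfderiv (IX.prod IF) IY Pullback.incl z (Γ.lin v - (A.pullback h).toFun z v)
  -- The terms in `Γ` agree after `map_sub`. Both connection terms become `A` applied to `Th v`,
  -- transported along the same equality `z.condition` from the tangent space at `h z.base` to the
  -- one at `π.proj z.incl`, so the casts match and need not be removed.
  rw [map_sub, Connection.pullback_spec, mfderiv_proj_incl_jet]

/-! ### From jets to sections -/

/-- The first jet of a section of `Y^h`, viewed as a section of `Y`, is the image of its first
jet. -/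
theorem jet1_sectionIncl_lin (hh : ∀ x, ρ.proj (h x) = x)
    (s : C^∞⟮IX, X; IX.prod IF, Pullback π h⟯) (hs : ∀ x, (π.pullback h).proj (s x) = x) (x : X) :
    (jet1 (contMDiff_composite ρ) (sectionIncl s) (composite_sectionIncl hh s hs) x).lin =
      (jetIncl hh (jet1 (π.pullback h).contMDiff_proj s hs x)).lin :=
  -- The underlying map of `sectionIncl s` is by definition `Pullback.incl ∘ s`, and `jetIncl`
  -- composes the linear part with `T incl`; the equality is therefore the chain rule at `x`.
  mfderiv_comp x (Pullback.mdifferentiable_incl (s x))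
    (s.contMDiff.mdifferentiable (by simp) x)

/-- A jet at given points `x` and `y` is determined by its linear part, so the chain rule above
already suffices. The equality is needed between jets, not just linear maps, because the covariant
differential takes a jet as its argument and the section case follows by substituting one jet for
the other. -/
theorem jet1_sectionIncl (hh : ∀ x, ρ.proj (h x) = x)
    (s : C^∞⟮IX, X; IX.prod IF, Pullback π h⟯) (hs : ∀ x, (π.pullback h).proj (s x) = x) (x : X) :
    jet1 (contMDiff_composite ρ) (sectionIncl s) (composite_sectionIncl hh s hs) x =
      jetIncl hh (jet1 (π.pullback h).contMDiff_proj s hs x) := by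
  have ext : ∀ {x : X} {y : Y} {Γ Γ' : Jet1 IY IX (ρ.proj ∘ π.proj) x y},
      Γ.lin = Γ'.lin → Γ = Γ' := by
    -- The two remaining fields are propositions, so once the linear parts are identified the jets
    -- agree by proof irrelevance.
    rintro x y ⟨_, _, _⟩ ⟨_, _, _⟩ rfl
    rfl
  exact ext (jet1_sectionIncl_lin hh s hs x)

end CompositeBundle

/-! ### The restriction theorem for jets and for sections -/

theorem mainTheorem4
    -- the manifold `X`
    {EX : Type*} [NormedAddCommGroup EX] [NormedSpace ℝ EX]
    {HX : Type*} [TopologicalSpace HX] {IX : ModelWithCorners ℝ EX HX}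
    {X : Type*} [TopologicalSpace X] [ChartedSpace HX X] [IsManifold IX ∞ X]
    -- the manifold `S` (total space of `Σ → X`) and the typical fiber `W` of `Σ → X`
    {ES : Type*} [NormedAddCommGroup ES] [NormedSpace ℝ ES]
    {HS : Type*} [TopologicalSpace HS] {IS : ModelWithCorners ℝ ES HS}
    {S : Type*} [TopologicalSpace S] [ChartedSpace HS S] [IsManifold IS ∞ S]
    {EW : Type*} [NormedAddCommGroup EW] [NormedSpace ℝ EW]
    {HW : Type*} [TopologicalSpace HW] {IW : ModelWithCorners ℝ EW HW}
    {W : Type*} [TopologicalSpace W] [ChartedSpace HW W] [IsManifold IW ∞ W]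
    -- the manifold `Y` and the typical fiber `F` of `Y → Σ`
    {EY : Type*} [NormedAddCommGroup EY] [NormedSpace ℝ EY]
    {HY : Type*} [TopologicalSpace HY] {IY : ModelWithCorners ℝ EY HY}
    {Y : Type*} [TopologicalSpace Y] [ChartedSpace HY Y] [IsManifold IY ∞ Y]
    {EF : Type*} [NormedAddCommGroup EF] [NormedSpace ℝ EF]
    {HF : Type*} [TopologicalSpace HF] {IF : ModelWithCorners ℝ EF HF}
    {F : Type*} [TopologicalSpace F] [ChartedSpace HF F] [IsManifold IF ∞ F]
    -- the composite bundle `Y → Σ → X`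
    (π : SmoothFiberBundle IY Y IS S IF F) (ρ : SmoothFiberBundle IS S IX X IW W)
    -- a connection on `Y → Σ` and a section of `Σ → X`
    (A : Connection π) (h : C^∞⟮IX, X; IS, S⟯) (hh : ∀ x, ρ.proj (h x) = x) :
    -- on the jets of `Y^h → X`, `D̃` restricted along `J¹Y^h → J¹Y` equals `D^{A_h}`
    (∀ (x : X) (z : Pullback π h) (Γ : Jet1 (IX.prod IF) IX (π.pullback h).proj x z)
      (v : TangentSpace IX x),
      verticalCovariantDifferential A (jetIncl hh Γ) v =
        Pullback.vertEquiv z (covariantDifferential (A.pullback h) Γ v)) ∧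
    -- in particular, `D̃ s = D^{A_h} s` for the sections `s` of `Y^h → X`
    (∀ (s : C^∞⟮IX, X; IX.prod IF, Pullback π h⟯) (hs : ∀ x, (π.pullback h).proj (s x) = x)
      (x : X) (v : TangentSpace IX x),
      verticalCovariantDifferential A
          (jet1 (contMDiff_composite ρ) (sectionIncl s) (composite_sectionIncl hh s hs) x) v =
        Pullback.vertEquiv (s x) (covariantDifferential (A.pullback h)
          (jet1 (π.pullback h).contMDiff_proj s hs x) v)) := by
  refine ⟨fun x z Γ v => verticalCovariantDifferential_jetIncl A hh Γ v, fun s hs x v => ?_⟩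
  -- The jet of the included section lies in the image of `jetIncl`, so the section case is the jet
  -- case for the first jet of `s` at `x`.
  rw [jet1_sectionIncl hh s hs x]
  exact verticalCovariantDifferential_jetIncl A hh _ v
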